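/- For a real number $s$, call $v \in \mathbb{R}^d$ $s$-sparse if it has at most $s$ nonzero entries. For $\alpha, \beta > 0$, a linear subspace $V \subseteq \mathbb{R}^d$ is called $(\alpha,\beta)$-regular if $\|\boldsymbol{\Pi}_{V_\perp} v\|_2 \ge \beta \|v\|_2$ for every $\alpha d$-sparse $v \in \mathbb{R}^d$, where $\boldsymbol{\Pi}_{V_\perp}$ is the orthogonal projection onto the orthogonal complement of $V$. A uniformly random $r$-dimensional subspace of $\mathbb{R}^d$ is one distributed according to the rotation-invariant Borel probability measure on the Grassmannian of $r$-dimensional subspaces, i.e. distributed as $UV_0$ with $U$ Haar-distributed on the orthogonal group $O(d)$ and $V_0 = \mathrm{span}(e_1,\dots,e_r)$. There are universal constants $\alpha, \gamma, C > 0$ such that for all integers $0 \le r \le d$ with $d \ge C r$, a uniformly random $r$-dimensional subspace $V$ of $\mathbb{R}^d$ is $(\alpha, \tfrac{1}{3})$-regular with probability at least $1 - \exp(-\gamma d)$. -/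

import Mathlib

open MeasureTheory

noncomputable section

/-- The Euclidean space `ℝ^d` with its `ℓ₂` norm. -/
abbrev Euc (d : ℕ) : Type := EuclideanSpace ℝ (Fin d)

/-- A vector `v ∈ ℝ^d` is `s`-sparse if it has at most `s` nonzero entries
(`s` is a real number, e.g. `s = α d`). -/
def IsSparse {d : ℕ} (s : ℝ) (v : Euc d) : Prop :=
  ({i : Fin d | v i ≠ 0}.ncard : ℝ) ≤ s

/-- A subspace `V ⊆ ℝ^d` is `(α, β)`-regular if `‖Π_{V^⊥} v‖₂ ≥ β ‖v‖₂` for every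
`α d`-sparse `v ∈ ℝ^d`. -/
def IsRegularSubspace {d : ℕ} (α β : ℝ) (V : Submodule ℝ (Euc d)) : Prop :=
  ∀ v : Euc d, IsSparse (α * d) v → β * ‖v‖ ≤ ‖Vᗮ.starProjection v‖

/-- The Grassmannian of `r`-dimensional linear subspaces of `ℝ^d`. -/
abbrev Gr (d r : ℕ) : Type := {V : Submodule ℝ (Euc d) // Module.finrank ℝ V = r}

/-- The usual topology of the Grassmannian, induced by `V ↦ Π_V`
(the orthogonal projection onto `V`, with the operator norm). -/
instance instTopologicalSpaceGr (d r : ℕ) : TopologicalSpace (Gr d r) :=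
  TopologicalSpace.induced (fun V : Gr d r => V.1.starProjection) inferInstance

/-- The Grassmannian carries its Borel `σ`-algebra. -/
instance instMeasurableSpaceGr (d r : ℕ) : MeasurableSpace (Gr d r) := borel _

instance instBorelSpaceGr (d r : ℕ) : BorelSpace (Gr d r) := ⟨rfl⟩

/-- The orthogonal group `O(d)`: linear maps `U` of `ℝ^d` with `Uᵀ U = U Uᵀ = 1`. -/
abbrev OrthGroup (d : ℕ) : Type := unitary (Euc d →L[ℝ] Euc d)

instance instContinuousStarEucEnd (d : ℕ) : ContinuousStar (Euc d →L[ℝ] Euc d) :=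
  ⟨(ContinuousLinearMap.adjoint (𝕜 := ℝ) (E := Euc d) (F := Euc d)).continuous⟩

instance instCompactSpaceOrthGroup (d : ℕ) : CompactSpace (OrthGroup d) := by
  have hc : IsClosed (unitary (Euc d →L[ℝ] Euc d) : Set (Euc d →L[ℝ] Euc d)) :=
    isClosed_unitary
  have hK : IsCompact (unitary (Euc d →L[ℝ] Euc d) : Set (Euc d →L[ℝ] Euc d)) := by
    refine (ProperSpace.isCompact_closedBall (0 : Euc d →L[ℝ] Euc d) 1).of_isClosed_subset hc ?_
    intro U hU
    rw [mem_closedBall_zero_iff]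
    refine U.opNorm_le_bound zero_le_one fun x => ?_
    rw [one_mul]
    exact (Unitary.norm_map ⟨U, hU⟩ x).le
  exact isCompact_iff_compactSpace.mp hK

/-- The normalized Haar measure of the orthogonal group `O(d)`. -/
def haarOrth (d : ℕ) : Measure (OrthGroup d) := Measure.haarMeasure ⊤

instance instIsProbabilityMeasureHaarOrth (d : ℕ) : IsProbabilityMeasure (haarOrth d) :=
  ⟨by simpa [haarOrth] using
    Measure.haarMeasure_self (K₀ := (⊤ : TopologicalSpace.PositiveCompacts (OrthGroup d)))⟩

/-- The image `U V` of an `r`-dimensional subspace `V` under an orthogonal map `U`. -/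
def rotate {d r : ℕ} (U : OrthGroup d) (V : Gr d r) : Gr d r :=
  ⟨V.1.map ((Unitary.linearIsometryEquiv U).toLinearEquiv : Euc d →ₗ[ℝ] Euc d), by
    rw [LinearEquiv.finrank_map_eq]; exact V.2⟩

/-- The coordinate subspace `span {e_i : i < r}` of `ℝ^d`, for `r ≤ d`. -/
def coordSubspace {d r : ℕ} (h : r ≤ d) : Gr d r :=
  ⟨Submodule.span ℝ (Set.range fun i : Fin r =>
      (EuclideanSpace.single (Fin.castLE h i) (1 : ℝ) : Euc d)), by
    have hli : LinearIndependent ℝ (fun i : Fin r =>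
        (EuclideanSpace.single (Fin.castLE h i) (1 : ℝ) : Euc d)) := by
      have := (EuclideanSpace.basisFun (Fin d) ℝ).orthonormal.linearIndependent.comp
        (Fin.castLE h) (Fin.castLE_injective h)
      have he : (fun i : Fin r => (EuclideanSpace.single (Fin.castLE h i) (1 : ℝ) : Euc d)) =
          ⇑(EuclideanSpace.basisFun (Fin d) ℝ) ∘ Fin.castLE h := by
        funext i
        simp
      rw [he]
      exact this
    rw [finrank_span_eq_card hli, Fintype.card_fin]⟩

/-- The uniform distribution on `r`-dimensional subspaces of `ℝ^d`: the law of `U V₀` where `U` is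
a Haar-distributed element of `O(d)` and `V₀` is a fixed `r`-dimensional subspace. -/
def uniformSubspace {d r : ℕ} (h : r ≤ d) : Measure (Gr d r) :=
  (haarOrth d).map fun U => rotate U (coordSubspace h)

theorem starProjection_rotate {d r : ℕ} (U : OrthGroup d) (V : Gr d r) :
    (rotate U V).1.starProjection =
      (U : Euc d →L[ℝ] Euc d) * V.1.starProjection * star (U : Euc d →L[ℝ] Euc d) := by
  ext1 x
  exact Submodule.starProjection_map_apply (Unitary.linearIsometryEquiv U) V.1 x

theorem continuous_rotate_left {d r : ℕ} (V : Gr d r) :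
    Continuous fun U : OrthGroup d => rotate U V := by
  refine continuous_induced_rng.mpr ?_
  have : ((fun W : Gr d r => W.1.starProjection) ∘ fun U : OrthGroup d => rotate U V) =
      fun U : OrthGroup d => (U : Euc d →L[ℝ] Euc d) * V.1.starProjection *
        star (U : Euc d →L[ℝ] Euc d) := funext fun U => starProjection_rotate U V
  rw [this]
  exact (continuous_subtype_val.mul continuous_const).mul continuous_subtype_val.star

theorem continuous_rotate_right {d r : ℕ} (U : OrthGroup d) :
    Continuous fun V : Gr d r => rotate U V := by
  refine continuous_induced_rng.mpr ?_
  have : ((fun W : Gr d r => W.1.starProjection) ∘ fun V : Gr d r => rotate U V) =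
      fun V : Gr d r => (U : Euc d →L[ℝ] Euc d) * V.1.starProjection *
        star (U : Euc d →L[ℝ] Euc d) := funext fun V => starProjection_rotate U V
  rw [this]
  exact (continuous_const.mul continuous_induced_dom).mul continuous_const

instance instIsProbabilityMeasureUniformSubspace {d r : ℕ} (h : r ≤ d) :
    IsProbabilityMeasure (uniformSubspace h) :=
  Measure.isProbabilityMeasure_map (continuous_rotate_left _).measurable.aemeasurable

/-- The uniform distribution is invariant under every orthogonal map. -/
theorem map_rotate_uniformSubspace {d r : ℕ} (h : r ≤ d) (U : OrthGroup d) :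
    (uniformSubspace h).map (rotate U) = uniformSubspace h := by
  have hc : rotate U ∘ (fun W : OrthGroup d => rotate W (coordSubspace h)) =
      (fun W : OrthGroup d => rotate W (coordSubspace h)) ∘ fun W => U * W := by
    funext W
    apply Subtype.ext
    simp only [Function.comp_apply, rotate]
    rw [← Submodule.map_comp]
    rfl
  have hm := (continuous_rotate_left (coordSubspace h)).measurable
  have hmU : Measurable fun W : OrthGroup d => U * W :=
    (continuous_const.mul continuous_id).measurable
  have hinv : (haarOrth d).map (fun W => U * W) = haarOrth d := by
    unfold haarOrth
    exact map_mul_left_eq_self _ U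
  unfold uniformSubspace
  rw [Measure.map_map (continuous_rotate_right U).measurable hm, hc,
    ← Measure.map_map hm hmU, hinv]

end

/-!
Regularity fails only if some nonzero sparse `v` has `‖Π_V v‖² > (8/9) ‖v‖²`, and this is excluded
by a union bound over supports and over a net of each coordinate subspace `ℝ^S`.

For one fixed vector `y ≠ 0` and `V = U V₀`, the event `5 ‖Π_V y‖² ≥ ‖y‖²` (`captureEvent`) has the
same Haar probability for every nonzero vector in place of `y`, because `O(d)` is transitive on
spheres. So `y` may be replaced by a Gaussian vector `x` independent of `U`; after exchanging the
integrals, `U` is absorbed by the rotation invariance of `exp (-‖x‖²)`, and what is left is the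
Gaussian mass of `{5 ‖Π_{V₀} x‖² ≥ ‖x‖²}`. There `1 ≤ exp (‖Π_{V₀} x‖² - ‖x‖² / 5)`, and the
resulting integral is a product of one-dimensional Gaussian integrals
(`haarOrth_captureEvent_mul_lintegral_le`). For `100 r ≤ d` its value is at most
`(0.92 * 1.01) ^ d` (`haarOrth_captureEvent_le_ofReal`).

A `1/2`-net of the unit sphere of `ℝ^S` with `5 ^ |S|` points controls the operator norm of `Π_V`
on `ℝ^S` up to a factor `2` (`exists_finset_net`, `norm_le_of_forall_mem_net`), so if none of the
events occurs, then `‖Π_V v‖² ≤ (4/5) ‖v‖²` for every `v ∈ ℝ^S`, which is more than enough. The sum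
of `5 ^ |S|` over all `S` with `|S| ≤ d / 1000` is at most `1.01 ^ (2 d)`, and
`0.92 * 1.01 ^ 3 < exp (-1/20)` (`haarOrth_not_regular_le`).
-/

/-! ### Gaussian integrals on Euclidean space -/

theorem lintegral_exp_neg_sum_mul_sq {d : ℕ} (c : Fin d → ℝ) (hc : ∀ i, 0 < c i) :
    ∫⁻ x : Euc d, ENNReal.ofReal (Real.exp (-∑ i, c i * x i ^ 2)) =
      ENNReal.ofReal (∏ i, √(Real.pi / c i)) := by
  have hint : ∀ i, Integrable fun t : ℝ => Real.exp (-c i * t ^ 2) :=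
    fun i => integrable_exp_neg_mul_sq (hc i)
  have hprod : (fun x : Fin d → ℝ => ∏ i, Real.exp (-c i * x i ^ 2)) =
      fun x => Real.exp (-∑ i, c i * x i ^ 2) := by
    funext x
    rw [← Real.exp_sum, ← Finset.sum_neg_distrib]
    simp only [neg_mul]
  have hI : Integrable (fun x : Fin d → ℝ => Real.exp (-∑ i, c i * x i ^ 2)) := by
    rw [← hprod]
    exact Integrable.fintype_prod hint
  have hval : ∫ x : Fin d → ℝ, Real.exp (-∑ i, c i * x i ^ 2) = ∏ i, √(Real.pi / c i) := by
    rw [← hprod, integral_fintype_prod_volume_eq_prod (fun i t => Real.exp (-c i * t ^ 2))]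
    simp only [integral_gaussian]
  rw [← hval, ofReal_integral_eq_lintegral_ofReal hI
    (Filter.Eventually.of_forall fun _ => (Real.exp_pos _).le)]
  exact (PiLp.volume_preserving_ofLp (Fin d)).lintegral_comp_emb
    (MeasurableEquiv.toLp 2 (Fin d → ℝ)).symm.measurableEmbedding
    (fun x : Fin d → ℝ => ENNReal.ofReal (Real.exp (-∑ i, c i * x i ^ 2)))

/-! ### Capturing a fixed vector -/

theorem norm_sq_starProjection_coordSubspace_le {d r : ℕ} (h : r ≤ d) (x : Euc d) :
    ‖(coordSubspace h).1.starProjection x‖ ^ 2 ≤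
      ∑ i : Fin d, (if (i : ℕ) < r then 1 else 0) * x i ^ 2 := by
  have hlow : ∀ i : Fin d, (i : ℕ) < r → (coordSubspace h).1.starProjection x i = x i := by
    intro i hi
    have hmem : (EuclideanSpace.single i (1 : ℝ) : Euc d) ∈ (coordSubspace h).1 :=
      Submodule.subset_span ⟨⟨i, hi⟩, rfl⟩
    have := Submodule.starProjection_inner_eq_zero (K := (coordSubspace h).1) x _ hmem
    rw [EuclideanSpace.inner_single_right] at this
    simp at this
    linarith
  have hhigh : ∀ y ∈ (coordSubspace h).1, ∀ i : Fin d, ¬ (i : ℕ) < r → y i = 0 := by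
    intro y hy i hi
    refine Submodule.span_induction (p := fun y _ => y i = 0) ?_ ?_ ?_ ?_ hy
    · rintro _ ⟨j, rfl⟩
      have : i ≠ Fin.castLE h j := by
        rintro rfl
        exact hi j.2
      simp [this]
    · rfl
    · intro a b _ _ ha hb
      simp [ha, hb]
    · intro a b _ hb
      simp [hb]
  rw [EuclideanSpace.real_norm_sq_eq]
  refine Finset.sum_le_sum fun i _ => ?_
  by_cases hi : (i : ℕ) < r
  · simp [hi, hlow i hi]
  · simp [hi, hhigh _ (Submodule.starProjection_apply_mem _ x) i hi]

theorem norm_starProjection_rotate {d r : ℕ} (U : OrthGroup d) (V : Gr d r) (x : Euc d) :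
    ‖(rotate U V).1.starProjection x‖ =
      ‖V.1.starProjection (((star U : OrthGroup d) : Euc d →L[ℝ] Euc d) x)‖ := by
  rw [starProjection_rotate]
  exact Unitary.norm_map U _

theorem exists_orthGroup_map_eq {d : ℕ} {x y : Euc d} (h : ‖x‖ = ‖y‖) :
    ∃ R : OrthGroup d, (R : Euc d →L[ℝ] Euc d) x = y :=
  ⟨Unitary.linearIsometryEquiv.symm (Submodule.reflection (ℝ ∙ (x - y))ᗮ),
    Submodule.reflection_sub h⟩

/-- The event that the random subspace `U V` captures at least a fifth of the squared length
of `x`. -/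
def captureEvent {d r : ℕ} (V : Gr d r) (x : Euc d) : Set (OrthGroup d) :=
  {U | ‖x‖ ^ 2 ≤ 5 * ‖(rotate U V).1.starProjection x‖ ^ 2}

theorem captureEvent_smul {d r : ℕ} (V : Gr d r) {a : ℝ} (ha : a ≠ 0) (x : Euc d) :
    captureEvent V (a • x) = captureEvent V x := by
  ext U
  have ha2 : 0 < ‖a‖ ^ 2 := by positivity
  simp only [captureEvent, Set.mem_ofPred_eq, map_smul, norm_smul, mul_pow]
  rw [mul_left_comm, mul_le_mul_iff_right₀ ha2]

/-- If `R x = y`, then left translation by `R` carries the event for `x` to the event for `y`. -/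
theorem haarOrth_captureEvent_eq_of_norm_eq {d r : ℕ} (V : Gr d r) {x y : Euc d}
    (h : ‖x‖ = ‖y‖) : haarOrth d (captureEvent V x) = haarOrth d (captureEvent V y) := by
  obtain ⟨R, hR⟩ := exists_orthGroup_map_eq h
  have hpre : (fun U => R * U) ⁻¹' captureEvent V y = captureEvent V x := by
    ext U
    have hy : ((star (R * U) : OrthGroup d) : Euc d →L[ℝ] Euc d) y =
        ((star U : OrthGroup d) : Euc d →L[ℝ] Euc d) x := by
      rw [star_mul, ← hR]
      change (((star U * star R) * R : OrthGroup d) : Euc d →L[ℝ] Euc d) x = _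
      rw [mul_assoc, Unitary.star_mul_self, mul_one]
    simp only [captureEvent, Set.mem_preimage, Set.mem_ofPred_eq, norm_starProjection_rotate]
    rw [hy, h]
  rw [← hpre]
  exact measure_preimage_mul (Measure.haarMeasure ⊤) R _

/-- For `x ≠ 0` this is an equality; for `x = 0` the event on the right is everything. -/
theorem haarOrth_captureEvent_le {d r : ℕ} (V : Gr d r) {y : Euc d} (hy : y ≠ 0) (x : Euc d) :
    haarOrth d (captureEvent V y) ≤ haarOrth d (captureEvent V x) := by
  by_cases hx : x = 0
  · have : captureEvent V x = Set.univ := by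
      ext U
      simp [captureEvent, hx]
    rw [this]
    exact measure_mono (Set.subset_univ _)
  · have hx' : ‖x‖ ≠ 0 := norm_ne_zero_iff.mpr hx
    have hy' : ‖y‖ ≠ 0 := norm_ne_zero_iff.mpr hy
    rw [← captureEvent_smul V (div_ne_zero hx' hy') y]
    refine (haarOrth_captureEvent_eq_of_norm_eq V ?_).le
    rw [norm_smul, norm_div, norm_norm, norm_norm]
    field_simp

theorem measurableSet_captureEvent_prod {d r : ℕ} (V : Gr d r) :
    MeasurableSet {p : Euc d × OrthGroup d | p.2 ∈ captureEvent V p.1} := by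
  simp only [captureEvent, Set.mem_ofPred_eq, norm_starProjection_rotate]
  refine (isClosed_le (by fun_prop) (continuous_const.mul (Continuous.pow
    (Continuous.norm (V.1.starProjection.continuous.comp ?_)) 2))).measurableSet
  have hstar : Continuous fun U : OrthGroup d => star (U : Euc d →L[ℝ] Euc d) :=
    continuous_subtype_val.star
  exact (hstar.comp continuous_snd).clm_apply continuous_fst

/-- The Gaussian comparison: the left side is at most the integral of `exp (-‖x‖²)` over the pairs
`(x, U)` with `U ∈ captureEvent V₀ x`. For fixed `U` the substitution `z = U⁻¹ x` turns the event
into `‖z‖² ≤ 5 ‖Π_{V₀} z‖²`, on which `-‖z‖² ≤ -(6/5) ‖z‖² + ‖Π_{V₀} z‖²`. -/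
theorem haarOrth_captureEvent_mul_lintegral_le {d r : ℕ} (h : r ≤ d) {y : Euc d} (hy : y ≠ 0) :
    haarOrth d (captureEvent (coordSubspace h) y) *
        ∫⁻ x : Euc d, ENNReal.ofReal (Real.exp (-∑ i, 1 * x i ^ 2)) ≤
      ∫⁻ x : Euc d, ENNReal.ofReal
        (Real.exp (-∑ i : Fin d, (if (i : ℕ) < r then 1 / 5 else 6 / 5) * x i ^ 2)) := by
  set V := coordSubspace h
  set w : Euc d → ENNReal := fun x => ENNReal.ofReal (Real.exp (-‖x‖ ^ 2)) with hw
  have hwm : Measurable w := by fun_prop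
  have hE := measurableSet_captureEvent_prod V
  have hmeas : Measurable (Function.uncurry fun (x : Euc d) (U : OrthGroup d) =>
      (captureEvent V x).indicator (fun _ => w x) U) :=
    (hwm.comp measurable_fst).indicator hE
  have hnorm : ∀ x : Euc d, ∑ i, 1 * x i ^ 2 = ‖x‖ ^ 2 := fun x => by
    simp [EuclideanSpace.real_norm_sq_eq]
  calc haarOrth d (captureEvent V y) *
        ∫⁻ x : Euc d, ENNReal.ofReal (Real.exp (-∑ i, 1 * x i ^ 2))
      = ∫⁻ x, haarOrth d (captureEvent V y) * w x := by
        simp only [hnorm]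
        exact (lintegral_const_mul _ hwm).symm
    _ ≤ ∫⁻ x : Euc d, ∫⁻ U, (captureEvent V x).indicator (fun _ => w x) U ∂haarOrth d := by
        refine lintegral_mono fun x => ?_
        have hx : MeasurableSet (captureEvent V x) := measurable_prodMk_left hE
        change _ * w x ≤ _
        rw [lintegral_indicator_const hx, mul_comm]
        exact mul_le_mul_right (haarOrth_captureEvent_le V hy x) _
    _ = ∫⁻ U, ∫⁻ x : Euc d, (captureEvent V x).indicator (fun _ => w x) U ∂volume ∂haarOrth d :=
        lintegral_lintegral_swap hmeas.aemeasurable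
    _ ≤ ∫⁻ _U : OrthGroup d, (∫⁻ x : Euc d, ENNReal.ofReal
          (Real.exp (-∑ i : Fin d, (if (i : ℕ) < r then 1 / 5 else 6 / 5) * x i ^ 2)))
          ∂haarOrth d := by
        refine lintegral_mono fun U => ?_
        rw [← (Unitary.linearIsometryEquiv (star U)).measurePreserving.lintegral_comp_emb
          (Unitary.linearIsometryEquiv (star U)).toHomeomorph.measurableEmbedding
          (fun z : Euc d => ENNReal.ofReal
            (Real.exp (-∑ i : Fin d, (if (i : ℕ) < r then 1 / 5 else 6 / 5) * z i ^ 2)))]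
        refine lintegral_mono fun x => ?_
        set z := (Unitary.linearIsometryEquiv (star U)) x with hz
        by_cases hx : U ∈ captureEvent V x
        · simp only [Set.indicator_of_mem hx, hw]
          refine ENNReal.ofReal_le_ofReal (Real.exp_le_exp.mpr ?_)
          have h1 : ‖x‖ ^ 2 ≤ 5 * ‖V.1.starProjection z‖ ^ 2 := by
            have := hx
            simp only [captureEvent, Set.mem_ofPred_eq, norm_starProjection_rotate] at this
            exact this
          have h2 := norm_sq_starProjection_coordSubspace_le h z
          have h3 : ‖x‖ ^ 2 = ∑ i, z i ^ 2 := by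
            rw [← EuclideanSpace.real_norm_sq_eq, hz, LinearIsometryEquiv.norm_map]
          have h4 : ∑ i : Fin d, (if (i : ℕ) < r then 1 / 5 else 6 / 5) * z i ^ 2 =
              6 / 5 * ∑ i, z i ^ 2 - ∑ i : Fin d, (if (i : ℕ) < r then 1 else 0) * z i ^ 2 := by
            rw [Finset.mul_sum, ← Finset.sum_sub_distrib]
            refine Finset.sum_congr rfl fun i _ => ?_
            split_ifs <;> ring
          rw [h4, ← h3]
          change ‖V.1.starProjection z‖ ^ 2 ≤ _ at h2
          linarith
        · simp [Set.indicator_of_notMem hx]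
    _ = _ := by simp

/-- The ratio of the two Gaussian integrals is `√5 ^ r * √(5/6) ^ (d - r)`; it is estimated with
`√5 ≤ 0.92 * 1.01 ^ 100` and `√(5/6) ≤ 0.92`. -/
theorem haarOrth_captureEvent_le_ofReal {d r : ℕ} (h : r ≤ d) (hr : 100 * r ≤ d)
    {y : Euc d} (hy : y ≠ 0) :
    haarOrth d (captureEvent (coordSubspace h) y) ≤
      ENNReal.ofReal ((0.92 * 1.01) ^ d) := by
  have key := haarOrth_captureEvent_mul_lintegral_le h hy
  rw [lintegral_exp_neg_sum_mul_sq (fun _ => 1) (fun _ => one_pos),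
    lintegral_exp_neg_sum_mul_sq (fun i : Fin d => if (i : ℕ) < r then 1 / 5 else 6 / 5)
      (fun i => by split_ifs <;> norm_num)] at key
  set A : ℝ := ∏ _i : Fin d, √(Real.pi / 1) with hA
  have hApos : 0 < A := Finset.prod_pos fun _ _ => Real.sqrt_pos.mpr (by positivity)
  have hprod : ∏ i : Fin d, √(Real.pi / (if (i : ℕ) < r then 1 / 5 else 6 / 5)) ≤
      (0.92 * 1.01) ^ d * A := by
    calc ∏ i : Fin d, √(Real.pi / (if (i : ℕ) < r then 1 / 5 else 6 / 5))
        ≤ ∏ i : Fin d, (0.92 * (if (i : ℕ) < r then 1.01 ^ 100 else 1)) * √(Real.pi / 1) := by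
          refine Finset.prod_le_prod (fun _ _ => Real.sqrt_nonneg _) fun i _ => ?_
          rw [div_one]
          have hpi := Real.pi_pos.le
          have hs := Real.sqrt_nonneg Real.pi
          split_ifs
          · rw [Real.sqrt_le_left (by positivity), mul_pow, Real.sq_sqrt hpi]
            have : (5 : ℝ) ≤ (0.92 * 1.01 ^ 100) ^ 2 := by norm_num
            nlinarith
          · rw [Real.sqrt_le_left (by positivity), mul_pow, Real.sq_sqrt hpi]
            have : (5 / 6 : ℝ) ≤ (0.92 * 1) ^ 2 := by norm_num
            nlinarith
      _ = 0.92 ^ d * 1.01 ^ (100 * r) * A := by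
          rw [Finset.prod_mul_distrib, Finset.prod_mul_distrib, ← hA, Finset.prod_ite]
          simp [Fin.card_filter_val_lt, h, pow_mul]
      _ ≤ (0.92 * 1.01) ^ d * A := by
          rw [mul_pow]
          gcongr
          norm_num
  have hA0 : ENNReal.ofReal A ≠ 0 := by simpa using hApos
  refine (ENNReal.mul_le_mul_iff_left hA0 ENNReal.ofReal_ne_top).mp (key.trans ?_)
  rw [← ENNReal.ofReal_mul (by positivity)]
  exact ENNReal.ofReal_le_ofReal hprod

/-! ### Nets -/

/-- The ball of radius `2` has a `1`-net with `5 ^ dim` points: otherwise `1`-separated sets in the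
ball could be enlarged indefinitely, against the packing bound `Besicovitch.card_le_of_separated`.
-/
theorem exists_finset_net (E : Type*) [NormedAddCommGroup E] [NormedSpace ℝ E]
    [FiniteDimensional ℝ E] :
    ∃ s : Finset E, s.card ≤ 5 ^ Module.finrank ℝ E ∧
      ∀ v : E, ‖v‖ ≤ 2 → ∃ n ∈ s, ‖n‖ ≤ 2 ∧ ‖v - n‖ < 1 := by
  classical
  by_contra! hcon
  have hbuild : ∀ m : ℕ, ∃ s : Finset E, s.card = m ∧ (∀ c ∈ s, ‖c‖ ≤ 2) ∧
      ∀ c ∈ s, ∀ c' ∈ s, c ≠ c' → 1 ≤ ‖c - c'‖ := by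
    intro m
    induction m with
    | zero => exact ⟨∅, by simp⟩
    | succ m ih =>
      obtain ⟨s, hcard, hs, hsep⟩ := ih
      obtain ⟨v, hv, hvs⟩ := hcon s (Besicovitch.card_le_of_separated s hs hsep)
      have hfar : ∀ c ∈ s, 1 ≤ ‖v - c‖ := fun c hc => hvs c hc (hs c hc)
      have hvnot : v ∉ s := fun hmem => by
        have := hfar v hmem
        norm_num at this
      refine ⟨insert v s, by rw [Finset.card_insert_of_notMem hvnot, hcard], ?_, ?_⟩
      · simpa [hv] using hs
      · intro c hc c' hc' hne
        rcases Finset.mem_insert.mp hc with rfl | hcs <;>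
          rcases Finset.mem_insert.mp hc' with rfl | hcs'
        · exact absurd rfl hne
        · exact hfar c' hcs'
        · rw [norm_sub_rev]
          exact hfar c hcs
        · exact hsep c hcs c' hcs' hne
  obtain ⟨s, hcard, hs, hsep⟩ := hbuild (5 ^ Module.finrank ℝ E + 1)
  have := Besicovitch.card_le_of_separated s hs hsep
  omega

/-- On the sphere of radius `2`, passing to the nearest net point costs `‖A‖`, so
`2 ‖A‖ ≤ 2 t + ‖A‖`. -/
theorem norm_le_of_forall_mem_net {E F : Type*} [NormedAddCommGroup E] [NormedSpace ℝ E]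
    [NormedAddCommGroup F] [NormedSpace ℝ F] {s : Finset E}
    (hs : ∀ v : E, ‖v‖ ≤ 2 → ∃ n ∈ s, ‖n‖ ≤ 2 ∧ ‖v - n‖ < 1) (A : E →L[ℝ] F) {t : ℝ}
    (ht : 0 ≤ t) (hA : ∀ n ∈ s, ‖A n‖ ≤ t * ‖n‖) : ‖A‖ ≤ 2 * t := by
  have hbound : ‖A‖ ≤ t + ‖A‖ / 2 := by
    refine A.opNorm_le_bound (by positivity) fun v => ?_
    by_cases hv : v = 0
    · simp [hv]
    have hv0 : 0 < ‖v‖ := norm_pos_iff.mpr hv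
    have hnorm : ‖(2 / ‖v‖) • v‖ = 2 := by
      rw [norm_smul, norm_div, norm_norm, div_mul_cancel₀ _ hv0.ne']
      norm_num
    obtain ⟨n, hns, hn, hdist⟩ := hs _ hnorm.le
    have h1 : ‖A n‖ ≤ t * 2 := (hA n hns).trans (by gcongr)
    have h2 : ‖A ((2 / ‖v‖) • v - n)‖ ≤ ‖A‖ :=
      (A.le_opNorm _).trans (mul_le_of_le_one_right (norm_nonneg _) hdist.le)
    have h3 : ‖A ((2 / ‖v‖) • v)‖ ≤ t * 2 + ‖A‖ := by
      have := norm_add_le (A n) (A ((2 / ‖v‖) • v - n))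
      rw [← map_add, add_sub_cancel] at this
      linarith
    rw [map_smul, norm_smul, norm_div, norm_norm, Real.norm_two, div_mul_eq_mul_div,
      div_le_iff₀ hv0] at h3
    linarith
  linarith

/-! ### The union bound -/

/-- The coordinate subspace `ℝ^S` of vectors supported in `S`, as a span of basis vectors. -/
noncomputable def supportedSubspace {d : ℕ} (S : Finset (Fin d)) : Submodule ℝ (Euc d) :=
  Submodule.span ℝ (S.image fun i => (EuclideanSpace.single i (1 : ℝ) : Euc d))

theorem finrank_supportedSubspace_le {d : ℕ} (S : Finset (Fin d)) :
    Module.finrank ℝ (supportedSubspace S) ≤ S.card :=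
  (finrank_span_finset_le_card _).trans Finset.card_image_le

theorem mem_supportedSubspace {d : ℕ} (S : Finset (Fin d)) (v : Euc d)
    (hv : ∀ i, v i ≠ 0 → i ∈ S) : v ∈ supportedSubspace S := by
  have hsum : v = ∑ i, v i • (EuclideanSpace.single i (1 : ℝ) : Euc d) := by
    simpa using ((EuclideanSpace.basisFun (Fin d) ℝ).sum_repr v).symm
  rw [hsum]
  refine Submodule.sum_mem _ fun i _ => ?_
  by_cases hi : v i = 0
  · simp [hi]
  · exact Submodule.smul_mem _ _ (Submodule.subset_span
      (by simpa using ⟨i, hv i hi, rfl⟩))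

theorem isRegularSubspace_of_forall_norm_starProjection_sq_le {d : ℕ} {α : ℝ}
    {V : Submodule ℝ (Euc d)}
    (hV : ∀ v : Euc d, IsSparse (α * d) v → ‖V.starProjection v‖ ^ 2 ≤ 4 / 5 * ‖v‖ ^ 2) :
    IsRegularSubspace α (1 / 3) V := by
  intro v hv
  have h1 := hV v hv
  have h2 := V.norm_sq_eq_add_norm_sq_starProjection v
  refine (pow_le_pow_iff_left₀ (by positivity) (by positivity) two_ne_zero).mp ?_
  nlinarith [sq_nonneg ‖v‖]

/-- The bad event is covered by the events `captureEvent V₀ n`, where `n` runs over the nonzero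
net points of the subspaces `ℝ^S` with `|S| ≤ d / 1000`. -/
theorem haarOrth_not_regular_le {d r : ℕ} (h : r ≤ d) (hr : 100 * r ≤ d) :
    haarOrth d {U | ¬ IsRegularSubspace (1 / 1000) (1 / 3) (rotate U (coordSubspace h)).1} ≤
      ENNReal.ofReal (Real.exp (-(1 / 20) * d)) := by
  classical
  set V := coordSubspace h
  choose net hcard hnet using fun S : Finset (Fin d) => exists_finset_net (supportedSubspace S)
  set 𝒮 : Finset (Finset (Fin d)) := {S | 1000 * S.card ≤ d} with h𝒮
  have hcover : {U | ¬ IsRegularSubspace (1 / 1000) (1 / 3) (rotate U V).1} ⊆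
      ⋃ S ∈ 𝒮, ⋃ n ∈ (net S).filter (· ≠ 0), captureEvent V (n : Euc d) := by
    intro U hU
    by_contra hnot
    refine hU (isRegularSubspace_of_forall_norm_starProjection_sq_le fun v hv => ?_)
    set S : Finset (Fin d) := {i | v i ≠ 0} with hS
    have hSmem : S ∈ 𝒮 := by
      have hn : {i : Fin d | v i ≠ 0}.ncard = S.card := by
        rw [← Set.ncard_coe_finset]
        simp [hS]
      rw [IsSparse, hn] at hv
      have : (1000 * S.card : ℝ) ≤ d := by linarith
      simpa [h𝒮] using (by exact_mod_cast this : 1000 * S.card ≤ d)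
    have hvS : v ∈ supportedSubspace S := mem_supportedSubspace S v fun i hi => by simpa [hS]
    have ht : (√(1 / 5 : ℝ)) ^ 2 = 1 / 5 := Real.sq_sqrt (by norm_num)
    have hA := norm_le_of_forall_mem_net (hnet S)
      ((rotate U V).1.starProjection.comp (supportedSubspace S).subtypeL)
      (Real.sqrt_nonneg (1 / 5)) fun n hn => ?_
    · have h1 := ContinuousLinearMap.le_of_opNorm_le _ hA (⟨v, hvS⟩ : supportedSubspace S)
      have h2 := pow_le_pow_left₀ (norm_nonneg _) h1 2
      rw [mul_pow, mul_pow, ht] at h2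
      calc ‖(rotate U V).1.starProjection v‖ ^ 2 ≤ 2 ^ 2 * (1 / 5) * ‖v‖ ^ 2 := h2
        _ = 4 / 5 * ‖v‖ ^ 2 := by ring
    · by_cases hn0 : n = 0
      · simp [hn0]
      have hUn : U ∉ captureEvent V (n : Euc d) := fun hmem => hnot <| by
        simp only [Set.mem_iUnion]
        exact ⟨S, hSmem, n, by simp [hn, hn0], hmem⟩
      simp only [captureEvent, Set.mem_ofPred_eq, not_le] at hUn
      refine (pow_le_pow_iff_left₀ (by positivity) (by positivity) two_ne_zero).mp ?_
      rw [mul_pow, ht]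
      change ‖(rotate U V).1.starProjection (n : Euc d)‖ ^ 2 ≤ 1 / 5 * ‖(n : Euc d)‖ ^ 2
      linarith
  have hterm : ∀ S ∈ 𝒮, haarOrth d (⋃ n ∈ (net S).filter (· ≠ 0), captureEvent V (n : Euc d)) ≤
      ENNReal.ofReal (5 ^ S.card * (0.92 * 1.01) ^ d) := by
    intro S _
    refine (measure_biUnion_finset_le _ _).trans ?_
    refine (Finset.sum_le_card_nsmul _ _ (ENNReal.ofReal ((0.92 * 1.01) ^ d)) fun n hn =>
      haarOrth_captureEvent_le_ofReal h hr ?_).trans ?_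
    · simpa using (Finset.mem_filter.mp hn).2
    · rw [← ENNReal.ofReal_nsmul, nsmul_eq_mul]
      refine ENNReal.ofReal_le_ofReal (mul_le_mul_of_nonneg_right ?_ (by positivity))
      have h1 : ((net S).filter (· ≠ 0)).card ≤ 5 ^ S.card :=
        (Finset.card_filter_le _ _).trans ((hcard S).trans
          (Nat.pow_le_pow_right (by norm_num) (finrank_supportedSubspace_le S)))
      exact_mod_cast h1
  refine (measure_mono hcover).trans ((measure_biUnion_finset_le _ _).trans
    ((Finset.sum_le_sum hterm).trans ?_))
  rw [← ENNReal.ofReal_sum_of_nonneg fun _ _ => by positivity]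
  refine ENNReal.ofReal_le_ofReal ?_
  rw [← Finset.sum_mul]
  -- Weighting each `S` by `(1/100) ^ |S|` costs `500 ^ |S| ≤ 1.01 ^ d`, and the weights add up to
  -- `(1 + 1/100) ^ d`.
  have hcount : ∑ S ∈ 𝒮, (5 : ℝ) ^ S.card ≤ 1.01 ^ d * 1.01 ^ d := by
    calc ∑ S ∈ 𝒮, (5 : ℝ) ^ S.card ≤ ∑ S ∈ 𝒮, (1 / 100 : ℝ) ^ S.card * 1.01 ^ d := by
          refine Finset.sum_le_sum fun S hS => ?_
          have hS' : 1000 * S.card ≤ d := by simpa [h𝒮] using hS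
          calc (5 : ℝ) ^ S.card = (1 / 100) ^ S.card * 500 ^ S.card := by
                rw [← mul_pow]
                norm_num
            _ ≤ (1 / 100) ^ S.card * (1.01 ^ 1000) ^ S.card := by
                gcongr
                have h5 : (5 : ℝ) ≤ 1.01 ^ 250 := by norm_num
                calc (500 : ℝ) ≤ 5 ^ 4 := by norm_num
                  _ ≤ (1.01 ^ 250) ^ 4 := by gcongr
                  _ = 1.01 ^ 1000 := by rw [← pow_mul]
            _ ≤ (1 / 100) ^ S.card * 1.01 ^ d := by
                rw [← pow_mul]
                gcongr
                norm_num
      _ ≤ ∑ S : Finset (Fin d), (1 / 100 : ℝ) ^ S.card * 1.01 ^ d :=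
          Finset.sum_le_sum_of_subset_of_nonneg (Finset.subset_univ _)
            fun _ _ _ => by positivity
      _ = 1.01 ^ d * 1.01 ^ d := by
          have := Fintype.sum_pow_mul_eq_add_pow (Fin d) (1 / 100 : ℝ) 1
          simp only [one_pow, mul_one, Fintype.card_fin] at this
          rw [← Finset.sum_mul, this]
          norm_num
  calc (∑ S ∈ 𝒮, (5 : ℝ) ^ S.card) * (0.92 * 1.01) ^ d
      ≤ 1.01 ^ d * 1.01 ^ d * (0.92 * 1.01) ^ d := by gcongr
    _ = (1.01 * 1.01 * (0.92 * 1.01)) ^ d := by rw [mul_pow (1.01 * 1.01), mul_pow 1.01 1.01]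
    _ ≤ Real.exp (-(1 / 20)) ^ d := by
        gcongr
        have := Real.add_one_le_exp (-(1 / 20) : ℝ)
        norm_num at this ⊢
        linarith
    _ = Real.exp (-(1 / 20) * d) := by
        rw [← Real.exp_nat_mul, mul_comm]

theorem mainTheorem7 :
    ∃ α γ C : ℝ, 0 < α ∧ 0 < γ ∧ 0 < C ∧
      ∀ (d r : ℕ) (h : r ≤ d), C * r ≤ d →
        1 - Real.exp (-γ * d) ≤
          (uniformSubspace h).real {V : Gr d r | IsRegularSubspace α (1 / 3) V.1} := by
  refine ⟨1 / 1000, 1 / 20, 100, by norm_num, by norm_num, by norm_num, fun d r h hr => ?_⟩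
  have hbad := haarOrth_not_regular_le h (by exact_mod_cast hr)
  set G : Set (Gr d r) := {V | IsRegularSubspace (1 / 1000) (1 / 3) V.1} with hG
  set f : OrthGroup d → Gr d r := fun U => rotate U (coordSubspace h) with hf
  -- `G` is not known to be measurable here; outer measure inequalities suffice.
  have hmap : (haarOrth d).real (f ⁻¹' G) ≤ (uniformSubspace h).real G :=
    ENNReal.toReal_mono (measure_ne_top _ _)
      (Measure.le_map_apply (continuous_rotate_left _).measurable.aemeasurable G)
  have hcompl : (haarOrth d).real (f ⁻¹' G)ᶜ ≤ Real.exp (-(1 / 20) * d) :=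
    ENNReal.toReal_le_of_le_ofReal (Real.exp_pos _).le hbad
  have htot := measureReal_union_le (μ := haarOrth d) (f ⁻¹' G) (f ⁻¹' G)ᶜ
  rw [Set.union_compl_self, probReal_univ] at htot
  linarith
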